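/- Let $X$ be a measurable space, and let $d_{\mathrm{TV}}(p,q)=\sup_E|p(E)-q(E)|$ be the total variation distance between probability distributions on $X$. A randomized learner $A$ assigns to each sample $S\in X^n$, for each $n\in\mathbb N$, a random probability distribution $A(S)$ on $X$ (its law depends measurably on $S$; the set of distributions carries the smallest $\sigma$-algebra for which all maps $q\mapsto q(E)$ and $q\mapsto d_{\mathrm{TV}}(p,q)$ are measurable). On samples of size $n$, $A$ is $(\varepsilon,0)$-differentially private (DP) if $\Pr[A(x)\in B]\le e^{\varepsilon}\Pr[A(x')\in B]$ for all measurable sets $B$ of distributions and all $x,x'\in X^n$ that differ in one entry. A nonempty class $\mathcal Q$ of probability distributions on $X$ is *pure DP learnable* if there are a randomized learner $A$ and a function $n_{\mathcal Q}:(0,1)^3\to\mathbb N$ such that for every $p\in\mathcal Q$, every $(\alpha,\beta,\varepsilon)\in(0,1)^3$ and every $n\ge n_{\mathcal Q}(\alpha,\beta,\varepsilon)$: (1) $A$ is $(\varepsilon,0)$-DP on samples of size $n$; and (2) with probability at least $1-\beta$ over a sample $S$ of $n$ i.i.d. draws from $p$ and over the randomness of $A$, $d_{\mathrm{TV}}(p,A(S))\le\alpha$.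 The class $\mathcal Q$ is *pure DP $c$-robustly learnable* if there are a randomized learner $A$ and a function $n_{\mathcal Q}:(0,1)^3\to\mathbb N$ such that for every probability distribution $p$ on $X$ (not necessarily in $\mathcal Q$), every $(\alpha,\beta,\varepsilon)\in(0,1)^3$ and every $n\ge n_{\mathcal Q}(\alpha,\beta,\varepsilon)$, (1) holds, and (2) holds with the bound replaced by $d_{\mathrm{TV}}(p,A(S))\le c\cdot\inf_{p'\in\mathcal Q}d_{\mathrm{TV}}(p,p')+\alpha$. **Theorem.** If a nonempty class $\mathcal Q$ of probability distributions on $X$ is pure DP learnable, then $\mathcal Q$ is pure DP $3$-robustly learnable. -/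

import Mathlib

open MeasureTheory ProbabilityTheory

noncomputable section

namespace DPRobust

/-- A probability distribution on the measurable space `X`. -/
def Distribution (X : Type*) [MeasurableSpace X] : Type _ :=
  {p : Measure X // IsProbabilityMeasure p}

variable {X : Type*} [MeasurableSpace X]

/-- Total variation distance, `sup_E |p(E) - q(E)|` over the measurable sets `E`. -/
def tvDist (p q : Distribution X) : ℝ :=
  ⨆ E : {E : Set X // MeasurableSet E}, |p.1.real E.1 - q.1.real E.1|

/-- Total variation distance from `p` to a class: `inf_{p' ∈ Q} d_TV(p, p')`. -/
def tvDistTo (p : Distribution X) (Q : Set (Distribution X)) : ℝ :=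
  ⨅ p' : Q, tvDist p p'.1

/-- The output space of a learner carries the smallest σ-algebra for which every evaluation
`q ↦ q E` (`E` measurable) and every distance function `q ↦ d_TV(p, q)` is measurable.
The distances are already measurable for the evaluations if the σ-algebra of `X` is
countably generated; adding them makes "`d_TV(p, A(S)) ≤ α`" an event over every `X`. -/
instance : MeasurableSpace (Distribution X) :=
  (⨆ E : {E : Set X // MeasurableSet E},
      MeasurableSpace.comap (fun q : Distribution X => q.1 E.1) inferInstance) ⊔
    (⨆ p : Distribution X, MeasurableSpace.comap (fun q => tvDist p q) inferInstance)

theorem measurable_tvDist (p : Distribution X) : Measurable (fun q => tvDist p q) :=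
  Measurable.mono (comap_measurable _)
    (le_sup_of_le_right
      (le_iSup (fun p : Distribution X =>
        MeasurableSpace.comap (fun q => tvDist p q) inferInstance) p)) le_rfl

variable (X) in
/-- A randomized learner: for every sample size `n`, a Markov kernel that sends a sample
`S ∈ X^n` to the law of the (random) distribution `A(S)`. -/
structure RandomizedLearner where
  toKernel : (n : ℕ) → Kernel (Fin n → X) (Distribution X)
  isMarkov : ∀ n, IsMarkovKernel (toKernel n)

/-- `x` and `x'` differ in (at most) one entry. -/
def Neighbors {n : ℕ} (x x' : Fin n → X) : Prop :=
  ∃ i, ∀ j, j ≠ i → x j = x' j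

/-- `(ε, δ)`-differential privacy of a randomized map on samples of size `n`. -/
def IsDP {n : ℕ} {Y : Type*} [MeasurableSpace Y] (K : Kernel (Fin n → X) Y) (ε δ : ℝ) : Prop :=
  ∀ x x' : Fin n → X, Neighbors x x' → ∀ B : Set Y, MeasurableSet B →
    K x B ≤ ENNReal.ofReal (Real.exp ε) * K x' B + ENNReal.ofReal δ

/-- The law of `A(S)` where `S` consists of `n` i.i.d. samples from `p`: the randomness is
that of the sample and that of the learner. -/
def outputLaw (A : RandomizedLearner X) (n : ℕ) (p : Distribution X) :
    Measure (Distribution X) :=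
  haveI := p.2
  (Measure.pi fun _ : Fin n => p.1).bind (A.toKernel n)

/-- `Q` is pure DP learnable. -/
def PureDPLearnable (Q : Set (Distribution X)) : Prop :=
  ∃ (A : RandomizedLearner X) (N : ℝ → ℝ → ℝ → ℕ),
    ∀ p ∈ Q, ∀ α ∈ Set.Ioo (0 : ℝ) 1, ∀ β ∈ Set.Ioo (0 : ℝ) 1, ∀ ε ∈ Set.Ioo (0 : ℝ) 1,
      ∀ n ≥ N α β ε,
        IsDP (A.toKernel n) ε 0 ∧
        ENNReal.ofReal (1 - β) ≤ outputLaw A n p {q | tvDist p q ≤ α}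

/-- `Q` is pure DP `c`-robustly learnable: as above, but `p` is an arbitrary distribution and
the error allowed is `c * d_TV(p, Q) + α`. -/
def PureDPRobustlyLearnable (c : ℝ) (Q : Set (Distribution X)) : Prop :=
  ∃ (A : RandomizedLearner X) (N : ℝ → ℝ → ℝ → ℕ),
    ∀ p : Distribution X,
      ∀ α ∈ Set.Ioo (0 : ℝ) 1, ∀ β ∈ Set.Ioo (0 : ℝ) 1, ∀ ε ∈ Set.Ioo (0 : ℝ) 1,
      ∀ n ≥ N α β ε,
        IsDP (A.toKernel n) ε 0 ∧
        ENNReal.ofReal (1 - β) ≤ outputLaw A n p {q | tvDist p q ≤ c * tvDistTo p Q + α}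

end DPRobust

end

/-!
Any two samples of size `n` are joined by `n` changes of one entry, so a pure DP learner outputs
an event with probabilities that differ by a factor of at most `e ^ (ε n)` over all samples. If `Q`
contains `k` distributions at pairwise distance more than `2 α`, the disjoint balls of radius `α`
around them all have probability at least `e ^ (-ε n) (1 - β)` on a single sample, which bounds
`k`. Thus `Q` is totally bounded for the total variation distance.

Conversely, let `q i` be a finite net of `Q`, and for each pair `i, j` let `S i j` be an event that
nearly attains `d_TV(q i, q j)`. On these finitely many events the empirical frequencies of a
sample from an arbitrary `p` are uniformly close to those of `p`, and a candidate `q i` that nearly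
minimizes the distance to the empirical frequencies is within `3 d_TV(p, Q)` of `p`, up to a small
error. The exponential mechanism finds such a candidate privately. This gives a learner for each
accuracy; letting the accuracy tend to `0` slowly with `n` gives one for all of them.
-/

noncomputable section

namespace DPRobust

open Filter Metric
open scoped ENNReal NNReal Topology

section MetricSpace

variable {M : Type*} [PseudoMetricSpace M]

lemma totallyBounded_of_frequently_packingNumber_ne_top {A : Set M}
    (h : ∃ᶠ r : ℝ≥0 in 𝓝[>] 0, packingNumber r A ≠ ⊤) : TotallyBounded A := by
  refine Metric.totallyBounded_iff.2 fun ε hε => ?_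
  lift ε to ℝ≥0 using hε.le
  obtain ⟨r, hr, -, hrε⟩ :=
    (h.and_eventually (Ioo_mem_nhdsGT (by exact_mod_cast hε : 0 < ε))).exists
  have hcov : coveringNumber r A ≠ ⊤ :=
    ne_top_of_le_ne_top hr (coveringNumber_le_packingNumber r A)
  exact ⟨minimalCover r A, finite_minimalCover,
    (isCover_minimalCover hcov).subset_iUnion_closedBall.trans
      (Set.iUnion₂_mono fun y _ => closedBall_subset_ball (by exact_mod_cast hrε))⟩

lemma exists_dist_lt_infDist_add {A T : Set M} {r : ℝ} (hA : A.Nonempty) (hr : 0 < r)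
    (hT : A ⊆ ⋃ y ∈ T, ball y r) (x : M) : ∃ y ∈ T, dist x y < infDist x A + 2 * r := by
  obtain ⟨z, hzA, hxz⟩ := (infDist_lt_iff hA).1 (lt_add_of_pos_right (infDist x A) hr)
  obtain ⟨y, hyT, hzy⟩ := Set.mem_iUnion₂.1 (hT hzA)
  exact ⟨y, hyT, by linarith [dist_triangle x z y, mem_ball.1 hzy]⟩

lemma dist_le_three_mul_add_of_approx_minimizer {N : Type*} [PseudoMetricSpace N] {f : M → N}
    (hf : LipschitzWith 1 f) {p q q₀ : M} {e : N} {η δ a : ℝ}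
    (hsep : dist q q₀ ≤ dist (f q) (f q₀) + η) (he : dist (f p) e ≤ δ)
    (hmin : dist (f q) e ≤ dist (f q₀) e + a) :
    dist p q ≤ 3 * dist p q₀ + (η + 2 * δ + a) := by
  have hq₀ : dist (f q₀) e ≤ dist p q₀ + δ := by
    have := hf.dist_le_mul p q₀
    rw [NNReal.coe_one, one_mul] at this
    linarith [dist_triangle_left (f q₀) e (f p)]
  calc dist p q ≤ dist p q₀ + dist q q₀ := dist_triangle_right _ _ _
    _ ≤ dist p q₀ + (dist (f q) e + dist (f q₀) e + η) := by
      linarith [dist_triangle_right (f q) (f q₀) e]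
    _ ≤ 3 * dist p q₀ + (η + 2 * δ + a) := by linarith

end MetricSpace

section Diagonal

lemma exists_tendsto_atTop_eventually {P : ℕ → ℕ → Prop} (h : ∀ k, ∀ᶠ n in atTop, P k n) :
    ∃ k : ℕ → ℕ, Tendsto k atTop atTop ∧ ∀ᶠ n in atTop, P (k n) n := by
  choose N hN using fun k => eventually_atTop.1 (h k)
  classical
  refine ⟨fun n => Nat.findGreatest (fun k => N k ≤ n) n, tendsto_atTop.2 fun k => ?_, ?_⟩
  · filter_upwards [eventually_ge_atTop k, eventually_ge_atTop (N k)] with n hkn hNn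
    exact Nat.le_findGreatest hkn hNn
  · filter_upwards [eventually_ge_atTop (N 0)] with n hn
    exact hN _ n (Nat.findGreatest_spec (P := fun k => N k ≤ n) n.zero_le hn)

lemma exists_tendsto_zero_eventually {P : ℝ → ℕ → Prop}
    (h : ∀ t > 0, ∀ᶠ n in atTop, P t n) :
    ∃ t : ℕ → ℝ, Tendsto t atTop (𝓝 0) ∧ ∀ᶠ n in atTop, P (t n) n := by
  obtain ⟨k, hk, hP⟩ := exists_tendsto_atTop_eventually
    fun k : ℕ => h (1 / ((k : ℝ) + 1)) Nat.one_div_pos_of_nat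
  exact ⟨_, tendsto_one_div_add_atTop_nhds_zero_nat.comp hk, hP⟩

end Diagonal

variable {X : Type*} [MeasurableSpace X]

section TotalVariation

namespace Distribution

instance (p : Distribution X) : IsProbabilityMeasure p.1 := p.2

lemma abs_measureReal_sub_le_one (p q : Distribution X) (E : Set X) :
    |p.1.real E - q.1.real E| ≤ 1 :=
  Real.dist_le_of_mem_Icc_01 ⟨measureReal_nonneg, measureReal_le_one⟩
    ⟨measureReal_nonneg, measureReal_le_one⟩

lemma abs_measureReal_sub_le_tvDist (p q : Distribution X) {E : Set X} (hE : MeasurableSet E) :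
    |p.1.real E - q.1.real E| ≤ tvDist p q :=
  le_ciSup (f := fun E : {E : Set X // MeasurableSet E} => |p.1.real E.1 - q.1.real E.1|)
    ⟨1, Set.forall_mem_range.2 fun E => abs_measureReal_sub_le_one p q E.1⟩ ⟨E, hE⟩

instance : PseudoMetricSpace (Distribution X) where
  dist := tvDist
  dist_self p := by simp [tvDist]
  dist_comm p q := by simp only [tvDist, abs_sub_comm]
  dist_triangle p q r := ciSup_le fun E => (abs_sub_le _ _ _).trans
    (add_le_add (abs_measureReal_sub_le_tvDist p q E.2) (abs_measureReal_sub_le_tvDist q r E.2))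

lemma setOf_tvDist_le (p : Distribution X) (r : ℝ) : {q | tvDist p q ≤ r} = closedBall p r :=
  Set.ext fun _ => (mem_closedBall' (x := p)).symm

lemma measurableSet_closedBall (p : Distribution X) (r : ℝ) : MeasurableSet (closedBall p r) :=
  setOf_tvDist_le p r ▸ measurableSet_le (measurable_tvDist p) measurable_const

lemma infDist_eq_tvDistTo (p : Distribution X) (Q : Set (Distribution X)) :
    infDist p Q = tvDistTo p Q :=
  infDist_eq_iInf

lemma exists_measurableSet_dist_lt (p q : Distribution X) {η : ℝ} (hη : 0 < η) :
    ∃ E, MeasurableSet E ∧ dist p q < |p.1.real E - q.1.real E| + η := by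
  obtain ⟨E, hE⟩ := exists_lt_of_lt_ciSup (show tvDist p q - η < ⨆ E : {E : Set X //
    MeasurableSet E}, |p.1.real E.1 - q.1.real E.1| from sub_lt_self _ hη)
  exact ⟨E.1, E.2, sub_lt_iff_lt_add.1 hE⟩

end Distribution

end TotalVariation

/-- The law of `n` independent draws from `μ`. -/
abbrev sampleLaw (n : ℕ) (μ : Measure X) : Measure (Fin n → X) := Measure.pi fun _ => μ

section GroupPrivacy

variable {n : ℕ} {Y : Type*} [MeasurableSpace Y] {K : Kernel (Fin n → X) Y} {ε : ℝ}

lemma IsDP.apply_le_exp_pow_card_mul (hK : IsDP K ε 0) {B : Set Y} (hB : MeasurableSet B)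
    (x' : Fin n → X) (s : Finset (Fin n)) :
    ∀ x : Fin n → X, (∀ j ∉ s, x j = x' j) →
      K x B ≤ ENNReal.ofReal (Real.exp ε) ^ s.card * K x' B := by
  induction s using Finset.induction_on with
  | empty => exact fun x hx => by simp [funext fun j => hx j (Finset.notMem_empty j)]
  | insert i s hi ih =>
    intro x hx
    have hnbr : Neighbors x (Function.update x i (x' i)) :=
      ⟨i, fun j hj => (Function.update_of_ne hj _ _).symm⟩
    have hagree : ∀ j ∉ s, Function.update x i (x' i) j = x' j := fun j hj => by
      rcases eq_or_ne j i with rfl | hji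
      · exact Function.update_self ..
      · rw [Function.update_of_ne hji, hx j (by simp [hj, hji])]
    calc K x B
        ≤ ENNReal.ofReal (Real.exp ε) * K (Function.update x i (x' i)) B := by
          simpa only [ENNReal.ofReal_zero, add_zero] using hK _ _ hnbr B hB
      _ ≤ ENNReal.ofReal (Real.exp ε) * (ENNReal.ofReal (Real.exp ε) ^ s.card * K x' B) := by
          gcongr
          exact ih _ hagree
      _ = ENNReal.ofReal (Real.exp ε) ^ (insert i s).card * K x' B := by
          rw [Finset.card_insert_of_notMem hi, pow_succ', mul_assoc]

lemma IsDP.bind_apply_le (hK : IsDP K ε 0) (μ : Measure (Fin n → X)) [IsProbabilityMeasure μ]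
    {B : Set Y} (hB : MeasurableSet B) (x₀ : Fin n → X) :
    μ.bind K B ≤ ENNReal.ofReal (Real.exp ε) ^ n * K x₀ B := by
  rw [Measure.bind_apply hB K.aemeasurable]
  calc ∫⁻ x, K x B ∂μ ≤ ∫⁻ _, ENNReal.ofReal (Real.exp ε) ^ n * K x₀ B ∂μ :=
        lintegral_mono fun x => by
          simpa using hK.apply_le_exp_pow_card_mul hB x₀ Finset.univ x (by simp)
    _ = ENNReal.ofReal (Real.exp ε) ^ n * K x₀ B := by simp

/-- By group privacy, all the disjoint events `B i` have probability at least `e ^ (-ε n) c` on one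
and the same sample. -/
lemma IsDP.card_mul_le_exp_pow [IsMarkovKernel K] (hK : IsDP K ε 0) {ι : Type*}
    {μ : ι → Measure (Fin n → X)} [∀ i, IsProbabilityMeasure (μ i)] {B : ι → Set Y}
    (hB : ∀ i, MeasurableSet (B i)) (hdisj : Pairwise (Function.onFun Disjoint B)) {c : ℝ≥0∞}
    (hc : ∀ i, c ≤ (μ i).bind K (B i)) :
    ENat.card ι * c ≤ ENNReal.ofReal (Real.exp ε) ^ n := by
  cases isEmpty_or_nonempty ι with
  | inl _ => simp [(ENat.card_eq_zero_iff_empty ι).2 ‹_›]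
  | inr hι =>
    obtain ⟨x₀⟩ := nonempty_of_isProbabilityMeasure (μ hι.some)
    calc ENat.card ι * c = ∑' _ : ι, c := (ENNReal.tsum_const c).symm
      _ ≤ ∑' i, ENNReal.ofReal (Real.exp ε) ^ n * K x₀ (B i) :=
          ENNReal.tsum_le_tsum fun i => (hc i).trans (hK.bind_apply_le (μ i) (hB i) x₀)
      _ = ENNReal.ofReal (Real.exp ε) ^ n * ∑' i, K x₀ (B i) := ENNReal.tsum_mul_left
      _ ≤ ENNReal.ofReal (Real.exp ε) ^ n * 1 := by
          gcongr
          exact (tsum_meas_le_meas_iUnion_of_disjoint (K x₀) hB hdisj).trans prob_le_one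
      _ = ENNReal.ofReal (Real.exp ε) ^ n := mul_one _

lemma IsDP.encard_mul_le_exp_pow {K : Kernel (Fin n → X) (Distribution X)} [IsMarkovKernel K]
    (hK : IsDP K ε 0) {C : Set (Distribution X)} {r : ℝ≥0} (hsep : IsSeparated (2 * r) C)
    {c : ℝ≥0∞} (hc : ∀ p ∈ C, c ≤ (sampleLaw n p.1).bind K (closedBall p r)) :
    C.encard * c ≤ ENNReal.ofReal (Real.exp ε) ^ n := by
  refine hK.card_mul_le_exp_pow (fun p : C => p.1.measurableSet_closedBall r)
    (fun p q hpq => closedBall_disjoint_closedBall ?_) fun p : C => hc p.1 p.2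
  have hlt : 2 * (r : ℝ≥0∞) < edist p.1 q.1 := hsep p.2 q.2 (Subtype.coe_ne_coe.2 hpq)
  rw [edist_nndist] at hlt
  rw [← coe_nndist, ← two_mul]
  exact_mod_cast hlt

lemma PureDPLearnable.packingNumber_ne_top {Q : Set (Distribution X)} (h : PureDPLearnable Q)
    {r : ℝ≥0} (hr : r ∈ Set.Ioo 0 2) : packingNumber r Q ≠ ⊤ := by
  obtain ⟨A, N, hA⟩ := h
  have hhalf : (1 / 2 : ℝ) ∈ Set.Ioo 0 1 := by norm_num
  have hr' : ((r / 2 : ℝ≥0) : ℝ) ∈ Set.Ioo 0 1 :=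
    ⟨by exact_mod_cast half_pos hr.1, by exact_mod_cast (div_lt_one two_pos).2 hr.2⟩
  set n := N (r / 2 : ℝ≥0) (1 / 2) (1 / 2)
  have := A.isMarkov n
  have hlearn := fun p (hp : p ∈ Q) => hA p hp _ hr' _ hhalf _ hhalf n le_rfl
  obtain ⟨k, hk⟩ := ENNReal.exists_nat_gt (r := ENNReal.ofReal (Real.exp (1 / 2)) ^ n /
    ENNReal.ofReal (1 - 1 / 2)) (ENNReal.div_ne_top (by finiteness) (by norm_num))
  suffices packingNumber r Q ≤ k from ne_top_of_le_ne_top (ENat.natCast_ne_top k) this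
  refine iSup_le fun C => iSup₂_le fun hCQ hsep => ?_
  rcases C.eq_empty_or_nonempty with rfl | ⟨p₀, hp₀⟩
  · simp
  have hsep' : IsSeparated (2 * (r / 2 : ℝ≥0)) C := by
    rwa [← ENNReal.coe_ofNat, ← ENNReal.coe_mul, mul_div_cancel₀ _ two_ne_zero]
  have hpack := (hlearn p₀ (hCQ hp₀)).1.encard_mul_le_exp_pow hsep' fun p hp =>
    Distribution.setOf_tvDist_le p _ ▸ (hlearn p (hCQ hp)).2
  have hcard := (ENNReal.le_div_iff_mul_le (by norm_num) (by norm_num)).2 hpack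
  exact_mod_cast hcard.trans hk.le

theorem PureDPLearnable.totallyBounded {Q : Set (Distribution X)} (h : PureDPLearnable Q) :
    TotallyBounded Q :=
  totallyBounded_of_frequently_packingNumber_ne_top <| Eventually.frequently <| by
    filter_upwards [Ioo_mem_nhdsGT two_pos] with r hr using h.packingNumber_ne_top hr

end GroupPrivacy

section ExponentialMechanism

variable {Ω Y ι : Type*} [MeasurableSpace Ω] [MeasurableSpace Y] [Fintype ι]

/-- The Gibbs distribution on `ι` of the energies `s`: weights proportional to `exp (-s i)`. -/
def gibbsWeight (s : ι → ℝ) (i : ι) : ℝ := Real.exp (-s i) / ∑ j, Real.exp (-s j)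

lemma gibbsWeight_nonneg (s : ι → ℝ) (i : ι) : 0 ≤ gibbsWeight s i := by
  unfold gibbsWeight
  positivity

lemma sum_exp_neg_pos [Nonempty ι] (s : ι → ℝ) : 0 < ∑ j, Real.exp (-s j) :=
  Finset.sum_pos (fun _ _ => Real.exp_pos _) Finset.univ_nonempty

lemma sum_gibbsWeight [Nonempty ι] (s : ι → ℝ) : ∑ i, gibbsWeight s i = 1 := by
  simp only [gibbsWeight, ← Finset.sum_div, div_self (sum_exp_neg_pos s).ne']

lemma gibbsWeight_le_exp_neg {s : ι → ℝ} {i i₀ : ι} {a : ℝ} (h : s i₀ + a ≤ s i) :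
    gibbsWeight s i ≤ Real.exp (-a) := by
  have hi₀ : Real.exp (-s i₀) ≤ ∑ j, Real.exp (-s j) :=
    Finset.single_le_sum (f := fun j => Real.exp (-s j)) (fun _ _ => (Real.exp_pos _).le)
      (Finset.mem_univ i₀)
  rw [gibbsWeight, div_le_iff₀ ((Real.exp_pos _).trans_le hi₀)]
  calc Real.exp (-s i) ≤ Real.exp (-a + -s i₀) := Real.exp_le_exp.2 (by linarith)
    _ = Real.exp (-a) * Real.exp (-s i₀) := Real.exp_add _ _
    _ ≤ Real.exp (-a) * ∑ j, Real.exp (-s j) := by gcongr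

/-- One factor `exp c` bounds the change of the numerator, the other that of the normalization. -/
lemma gibbsWeight_le_exp_mul {s s' : ι → ℝ} {c : ℝ} (h : ∀ i, |s i - s' i| ≤ c) (i : ι) :
    gibbsWeight s i ≤ Real.exp (2 * c) * gibbsWeight s' i := by
  have : Nonempty ι := ⟨i⟩
  have hnum : Real.exp (-s i) ≤ Real.exp c * Real.exp (-s' i) := by
    rw [← Real.exp_add]
    exact Real.exp_le_exp.2 (by linarith [(abs_le.1 (h i)).1])
  have hden : ∑ j, Real.exp (-s' j) ≤ Real.exp c * ∑ j, Real.exp (-s j) := by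
    simp only [Finset.mul_sum, ← Real.exp_add]
    exact Finset.sum_le_sum fun j _ => Real.exp_le_exp.2 (by linarith [(abs_le.1 (h j)).2])
  rw [gibbsWeight, gibbsWeight, mul_div_assoc',
    div_le_div_iff₀ (sum_exp_neg_pos s) (sum_exp_neg_pos s')]
  calc Real.exp (-s i) * ∑ j, Real.exp (-s' j)
      ≤ (Real.exp c * Real.exp (-s' i)) * (Real.exp c * ∑ j, Real.exp (-s j)) := by gcongr
    _ = Real.exp (2 * c) * Real.exp (-s' i) * ∑ j, Real.exp (-s j) := by
      rw [two_mul, Real.exp_add]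
      ring

/-- The exponential mechanism with candidates `y i` and losses `s i`: on input `x` it outputs `y i`
with the Gibbs probability of the energies `s · x`. The privacy parameter is absorbed into `s`. -/
def expMechanism (s : ι → Ω → ℝ) (hs : ∀ i, Measurable (s i)) (y : ι → Y) : Kernel Ω Y where
  toFun x := ∑ i, ENNReal.ofReal (gibbsWeight (s · x) i) • Measure.dirac (y i)
  measurable' := Measure.measurable_of_measurable_coe _ fun B _ => by
    simp only [Measure.finsetSum_apply, Measure.smul_apply, smul_eq_mul, gibbsWeight]
    fun_prop

lemma expMechanism_apply {s : ι → Ω → ℝ} (hs : ∀ i, Measurable (s i)) (y : ι → Y) (x : Ω)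
    (B : Set Y) : expMechanism s hs y x B =
      ∑ i, ENNReal.ofReal (gibbsWeight (s · x) i) * Measure.dirac (y i) B := by
  simp [expMechanism]

instance [Nonempty ι] {s : ι → Ω → ℝ} (hs : ∀ i, Measurable (s i)) (y : ι → Y) :
    IsMarkovKernel (expMechanism s hs y) :=
  ⟨fun x => ⟨by
    simp only [expMechanism_apply, measure_univ, mul_one]
    rw [← ENNReal.ofReal_sum_of_nonneg fun i _ => gibbsWeight_nonneg _ i, sum_gibbsWeight,
      ENNReal.ofReal_one]⟩⟩

lemma isDP_expMechanism {n : ℕ} {s : ι → (Fin n → X) → ℝ} (hs : ∀ i, Measurable (s i))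
    (y : ι → Y) {ε : ℝ} (h : ∀ x x', Neighbors x x' → ∀ i, |s i x - s i x'| ≤ ε / 2) :
    IsDP (expMechanism s hs y) ε 0 := by
  intro x x' hx B _
  rw [ENNReal.ofReal_zero, add_zero, expMechanism_apply, expMechanism_apply, Finset.mul_sum]
  refine Finset.sum_le_sum fun i _ => ?_
  rw [← mul_assoc, ← ENNReal.ofReal_mul (Real.exp_pos _).le]
  gcongr
  simpa only [mul_div_cancel₀ ε two_ne_zero] using gibbsWeight_le_exp_mul (h x x' hx) i

lemma expMechanism_apply_le {s : ι → Ω → ℝ} (hs : ∀ i, Measurable (s i)) (y : ι → Y) {x : Ω}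
    {B : Set Y} (hB : MeasurableSet B) {i₀ : ι} {a : ℝ} (h : ∀ i, y i ∈ B → s i₀ x + a ≤ s i x) :
    expMechanism s hs y x B ≤ ENNReal.ofReal (Fintype.card ι * Real.exp (-a)) := by
  rw [expMechanism_apply]
  calc ∑ i, ENNReal.ofReal (gibbsWeight (s · x) i) * Measure.dirac (y i) B
      ≤ ∑ _i : ι, ENNReal.ofReal (Real.exp (-a)) := by
        refine Finset.sum_le_sum fun i _ => ?_
        by_cases hi : y i ∈ B
        · exact (mul_le_of_le_one_right' prob_le_one).trans
            (ENNReal.ofReal_le_ofReal (gibbsWeight_le_exp_neg (s := (s · x)) (h i hi)))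
        · simp [Measure.dirac_apply' _ hB, hi]
    _ = ENNReal.ofReal (Fintype.card ι * Real.exp (-a)) := by
        simp [ENNReal.ofReal_mul]

end ExponentialMechanism

section EmpiricalFrequency

variable {n : ℕ} {S : Set X}

/-- The fraction of the sample `x` that lies in `S` (`0` for the empty sample). -/
def empFreq {n : ℕ} (S : Set X) (x : Fin n → X) : ℝ :=
  (∑ i, S.indicator (fun _ => (1 : ℝ)) (x i)) / n

lemma Neighbors.dist_empFreq_le {X : Type*} {x x' : Fin n → X} (h : Neighbors x x') (S : Set X) :
    dist (empFreq S x) (empFreq S x') ≤ 1 / n := by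
  obtain ⟨i, hi⟩ := h
  rw [Real.dist_eq, empFreq, empFreq, ← sub_div, abs_div, Nat.abs_cast, ← Finset.sum_sub_distrib,
    Finset.sum_eq_single i (fun j _ hj => by rw [hi j hj, sub_self]) (by simp)]
  gcongr
  by_cases h₁ : x i ∈ S <;> by_cases h₂ : x' i ∈ S <;> simp [h₁, h₂]

lemma measurable_empFreq (hS : MeasurableSet S) : Measurable (empFreq (n := n) S) := by
  have : Measurable (S.indicator fun _ => (1 : ℝ)) := measurable_const.indicator hS
  unfold empFreq
  fun_prop

variable (μ : Measure X) [IsProbabilityMeasure μ]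

lemma memLp_indicator_eval (hS : MeasurableSet S) (i : Fin n) :
    MemLp (fun x : Fin n → X => S.indicator (fun _ => (1 : ℝ)) (x i)) 2 (sampleLaw n μ) :=
  (memLp_indicator_const 2 hS 1 (Or.inr (measure_ne_top μ S))).comp_measurePreserving
    (measurePreserving_eval (fun _ : Fin n => μ) i)

lemma memLp_empFreq (hS : MeasurableSet S) : MemLp (empFreq (n := n) S) 2 (sampleLaw n μ) := by
  unfold empFreq
  simp only [div_eq_mul_inv]
  exact (memLp_finsetSum _ fun i _ => memLp_indicator_eval μ hS i).mul_const _

lemma integral_empFreq (hn : 0 < n) (hS : MeasurableSet S) :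
    ∫ x, empFreq S x ∂sampleLaw n μ = μ.real S := by
  have heval (i : Fin n) :
      ∫ x, S.indicator (fun _ => (1 : ℝ)) (x i) ∂sampleLaw n μ = μ.real S := by
    rw [integral_comp_eval (μ := fun _ : Fin n => μ) (i := i)
      (measurable_const.indicator hS).aestronglyMeasurable, integral_indicator_const _ hS,
      smul_eq_mul, mul_one]
  simp only [empFreq]
  rw [integral_div, integral_finsetSum _ fun i _ =>
    (memLp_indicator_eval μ hS i).integrable one_le_two]
  simp [heval, hn.ne']

lemma variance_empFreq_le (hS : MeasurableSet S) :
    variance (empFreq S) (sampleLaw n μ) ≤ 1 / n := by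
  have hmeas : Measurable (S.indicator fun _ => (1 : ℝ)) := measurable_const.indicator hS
  have hbdd (y : X) : S.indicator (fun _ => (1 : ℝ)) y ∈ Set.Icc (0 : ℝ) 1 := by
    by_cases h : y ∈ S <;> simp [h]
  have hsum : variance (∑ i, fun x : Fin n → X => S.indicator (fun _ => (1 : ℝ)) (x i))
      (sampleLaw n μ) ≤ n := by
    rw [variance_sum_pi fun _ => memLp_indicator_const 2 hS 1 (Or.inr (measure_ne_top μ S))]
    calc ∑ _i : Fin n, variance (S.indicator fun _ => (1 : ℝ)) μ ≤ ∑ _i : Fin n, (1 : ℝ) :=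
          Finset.sum_le_sum fun i _ => (variance_le_sq_of_bounded (ae_of_all _ hbdd)
            hmeas.aemeasurable).trans (by norm_num)
      _ = n := by simp
  have hscale : empFreq S = fun x : Fin n → X =>
      (n : ℝ)⁻¹ * (∑ i, fun x : Fin n → X => S.indicator (fun _ => (1 : ℝ)) (x i)) x := by
    ext x
    simp [empFreq, div_eq_inv_mul]
  rw [hscale, variance_const_mul]
  calc (n : ℝ)⁻¹ ^ 2 * variance _ (sampleLaw n μ) ≤ (n : ℝ)⁻¹ ^ 2 * (n : ℝ) := by gcongr
    _ = 1 / (n : ℝ) := by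
      rcases eq_or_ne (n : ℝ) 0 with h | h
      · simp [h]
      · field_simp

lemma measure_le_dist_empFreq (hn : 0 < n) (hS : MeasurableSet S) {η : ℝ} (hη : 0 < η) :
    sampleLaw n μ {x | η ≤ dist (μ.real S) (empFreq S x)} ≤ ENNReal.ofReal (1 / (n * η ^ 2)) := by
  have hcheb := meas_ge_le_variance_div_sq (memLp_empFreq (n := n) μ hS) hη
  simp only [integral_empFreq μ hn hS, ← Real.dist_eq, dist_comm _ (μ.real S)] at hcheb
  refine hcheb.trans (ENNReal.ofReal_le_ofReal ?_)
  rw [← div_div]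
  gcongr
  exact variance_empFreq_le μ hS

end EmpiricalFrequency

section Profile

variable {ι κ : Type*} {S : κ → Set X}

/-- The vector of the probabilities of the sets `S k`. Its sup-metric compares distributions by
the worst of these sets, as the total variation distance does with all measurable sets. -/
def profile (S : κ → Set X) (p : Distribution X) : κ → ℝ := fun k => p.1.real (S k)

/-- The empirical counterpart of `profile`: the vector of the frequencies of the sets `S k`. -/
def empProfile {n : ℕ} (S : κ → Set X) (x : Fin n → X) : κ → ℝ := fun k => empFreq (S k) x

lemma measurable_empProfile (hS : ∀ k, MeasurableSet (S k)) (n : ℕ) :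
    Measurable (empProfile (n := n) S) :=
  measurable_pi_lambda _ fun k => measurable_empFreq (hS k)

variable [Fintype κ]

lemma lipschitzWith_profile (hS : ∀ k, MeasurableSet (S k)) : LipschitzWith 1 (profile S) :=
  .mk_one fun p q => (dist_pi_le_iff dist_nonneg).2 fun k =>
    p.abs_measureReal_sub_le_tvDist q (hS k)

lemma Neighbors.dist_empProfile_le {X : Type*} {n : ℕ} {x x' : Fin n → X} (h : Neighbors x x')
    (S : κ → Set X) : dist (empProfile S x) (empProfile S x') ≤ 1 / n :=
  (dist_pi_le_iff (by positivity)).2 fun k => h.dist_empFreq_le (S k)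

lemma measure_le_dist_empProfile (p : Distribution X) {n : ℕ} (hn : 0 < n)
    (hS : ∀ k, MeasurableSet (S k)) {η : ℝ} (hη : 0 < η) :
    sampleLaw n p.1 {x | η ≤ dist (profile S p) (empProfile S x)} ≤
      ENNReal.ofReal (Fintype.card κ / (n * η ^ 2)) := by
  have hunion : {x : Fin n → X | η ≤ dist (profile S p) (empProfile S x)} ⊆
      ⋃ k, {x | η ≤ dist (p.1.real (S k)) (empFreq (S k) x)} := fun x hx => by
    by_contra h
    simp only [Set.mem_iUnion, Set.mem_ofPred_eq, not_exists, not_le] at h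
    exact hx.not_gt ((dist_pi_lt_iff hη).2 h)
  calc sampleLaw n p.1 {x | η ≤ dist (profile S p) (empProfile S x)}
      ≤ ∑ k, sampleLaw n p.1 {x | η ≤ dist (p.1.real (S k)) (empFreq (S k) x)} :=
        (measure_mono hunion).trans (measure_iUnion_fintype_le _ _)
    _ ≤ ∑ _k : κ, ENNReal.ofReal (1 / (n * η ^ 2)) :=
        Finset.sum_le_sum fun k _ => measure_le_dist_empFreq p.1 hn (hS k) hη
    _ = ENNReal.ofReal (Fintype.card κ / (n * η ^ 2)) := by
        rw [Finset.sum_const, Finset.card_univ, ← ENNReal.ofReal_nsmul, nsmul_eq_mul, mul_one_div]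

/-- The sets `S (i, j)` are those of Yatracos: `S (i, j)` nearly attains the total variation
distance between `q i` and `q j`. -/
lemma exists_dist_le_dist_profile_add [Fintype ι] (q : ι → Distribution X) {η : ℝ} (hη : 0 < η) :
    ∃ S : ι × ι → Set X, (∀ k, MeasurableSet (S k)) ∧
      ∀ i j, dist (q i) (q j) ≤ dist (profile S (q i)) (profile S (q j)) + η := by
  choose S hS hdist using fun k : ι × ι =>
    (q k.1).exists_measurableSet_dist_lt (q k.2) hη
  refine ⟨S, hS, fun i j => (hdist (i, j)).le.trans ?_⟩
  gcongr
  exact dist_le_pi_dist (profile S (q i)) (profile S (q j)) (i, j)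

end Profile

section MinimumDistance

lemma bind_apply_le_add {Ω Y : Type*} [MeasurableSpace Ω] [MeasurableSpace Y] (μ : Measure Ω)
    [IsProbabilityMeasure μ] (K : Kernel Ω Y) [IsMarkovKernel K] {G : Set Ω} {B : Set Y}
    (hB : MeasurableSet B) {b : ℝ≥0∞} (h : ∀ x ∈ G, K x B ≤ b) : μ.bind K B ≤ μ Gᶜ + b := by
  rw [Measure.bind_apply hB K.aemeasurable]
  calc ∫⁻ x, K x B ∂μ ≤ ∫⁻ x, Gᶜ.indicator 1 x + b ∂μ := lintegral_mono fun x => by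
        by_cases hx : x ∈ G
        · simpa [hx] using h x hx
        · simpa [hx] using le_add_right prob_le_one
    _ ≤ μ Gᶜ + b := by
        rw [lintegral_add_right _ measurable_const, lintegral_const, measure_univ, mul_one]
        gcongr
        exact lintegral_indicator_one_le _

variable {ι κ : Type*} [Fintype ι] [Fintype κ] {S : κ → Set X} {ε : ℝ} {n : ℕ}

/-- Private minimum distance estimation: the exponential mechanism over the candidates `q i`, with
loss the distance between the profile of `q i` and that of the sample. The factor `ε / 2 * n` is
what `ε`-privacy allows, since changing one entry moves the profile of the sample by `1 / n`. -/
def minDistMechanism (hS : ∀ k, MeasurableSet (S k)) (q : ι → Distribution X) (ε : ℝ) (n : ℕ) :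
    Kernel (Fin n → X) (Distribution X) :=
  expMechanism (fun i x => ε / 2 * n * dist (profile S (q i)) (empProfile S x))
    (fun _ => (measurable_const.dist (measurable_empProfile hS n)).const_mul _) q

instance [Nonempty ι] (hS : ∀ k, MeasurableSet (S k)) (q : ι → Distribution X) (ε : ℝ) (n : ℕ) :
    IsMarkovKernel (minDistMechanism hS q ε n) :=
  inferInstanceAs (IsMarkovKernel (expMechanism _ _ _))

lemma isDP_minDistMechanism (hS : ∀ k, MeasurableSet (S k)) (q : ι → Distribution X)
    (hε : 0 ≤ ε) : IsDP (minDistMechanism hS q ε n) ε 0 := by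
  refine isDP_expMechanism _ _ fun x x' h i => ?_
  have hscale : 0 ≤ ε / 2 * n := by positivity
  rw [← mul_sub, abs_mul, abs_of_nonneg hscale]
  calc ε / 2 * n * |dist (profile S (q i)) (empProfile S x) -
        dist (profile S (q i)) (empProfile S x')|
      ≤ ε / 2 * n * (1 / n) := mul_le_mul_of_nonneg_left
        ((dist_dist_dist_le_right _ _ _).trans (h.dist_empProfile_le S)) hscale
    _ = ε / 2 * (n * (n : ℝ)⁻¹) := by rw [one_div, mul_assoc]
    _ ≤ ε / 2 := mul_le_of_le_one_right (by positivity) mul_inv_le_one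

lemma minDistMechanism_apply_le (hS : ∀ k, MeasurableSet (S k)) {q : ι → Distribution X} {η : ℝ}
    (hsep : ∀ i j, dist (q i) (q j) ≤ dist (profile S (q i)) (profile S (q j)) + η)
    (hε : 0 ≤ ε) (p : Distribution X) (i₀ : ι) {x : Fin n → X}
    (hx : dist (profile S p) (empProfile S x) < η) :
    minDistMechanism hS q ε n x (closedBall p (3 * dist p (q i₀) + 4 * η))ᶜ ≤
      ENNReal.ofReal (Fintype.card ι * Real.exp (-(ε / 2 * n * η))) := by
  refine expMechanism_apply_le _ _ (p.measurableSet_closedBall _).compl (i₀ := i₀) fun i hi => ?_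
  rw [← mul_add]
  gcongr
  by_contra! hlt
  refine hi (mem_closedBall'.2 ?_)
  have := dist_le_three_mul_add_of_approx_minimizer (lipschitzWith_profile hS) (hsep i i₀) hx.le
    hlt.le
  linarith

lemma bind_minDistMechanism_apply_le [Nonempty ι] (hS : ∀ k, MeasurableSet (S k))
    {q : ι → Distribution X} {η : ℝ} (hη : 0 < η)
    (hsep : ∀ i j, dist (q i) (q j) ≤ dist (profile S (q i)) (profile S (q j)) + η)
    (hε : 0 ≤ ε) (hn : 0 < n) (p : Distribution X) (i₀ : ι) :
    (sampleLaw n p.1).bind (minDistMechanism hS q ε n)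
        (closedBall p (3 * dist p (q i₀) + 4 * η))ᶜ ≤
      ENNReal.ofReal (Fintype.card κ / (n * η ^ 2) +
        Fintype.card ι * Real.exp (-(ε / 2 * n * η))) := by
  refine (bind_apply_le_add _ _ (G := {x | dist (profile S p) (empProfile S x) < η})
    (p.measurableSet_closedBall _).compl fun x hx => minDistMechanism_apply_le hS hsep hε p i₀
      hx).trans ?_
  rw [ENNReal.ofReal_add (by positivity) (by positivity)]
  gcongr
  simpa only [Set.compl_ofPred, not_lt] using measure_le_dist_empProfile p hn hS hη

lemma tendsto_div_add_mul_exp_neg (a b : ℝ) {η : ℝ} (hη : 0 < η) (hε : 0 < ε) :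
    Tendsto (fun n : ℕ => a / (n * η ^ 2) + b * Real.exp (-(ε / 2 * n * η))) atTop (𝓝 0) := by
  have hn : Tendsto (fun n : ℕ => (n : ℝ)) atTop atTop := tendsto_natCast_atTop_atTop
  have hdiv := (hn.atTop_mul_const (pow_pos hη 2)).const_div_atTop a
  have hexp := (Real.tendsto_exp_neg_atTop_nhds_zero.comp
    ((hn.const_mul_atTop (half_pos hε)).atTop_mul_const hη)).const_mul b
  simpa using hdiv.add hexp

end MinimumDistance

section Learning

/-- `K` is a private `c`-robust learner for `Q` on samples of size `n`, with accuracy `α`,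
failure probability `β` and privacy `ε`: the requirement of `PureDPRobustlyLearnable` for one
choice of the parameters and of the sample size. -/
structure IsPrivateRobust (c : ℝ) (Q : Set (Distribution X)) (α β ε : ℝ) {n : ℕ}
    (K : Kernel (Fin n → X) (Distribution X)) : Prop where
  isDP : IsDP K ε 0
  le_bind_apply (p : Distribution X) :
    ENNReal.ofReal (1 - β) ≤ (sampleLaw n p.1).bind K (closedBall p (c * infDist p Q + α))

variable {c : ℝ} {Q : Set (Distribution X)}

lemma IsPrivateRobust.mono {n : ℕ} {K : Kernel (Fin n → X) (Distribution X)}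
    {α α' β β' ε ε' : ℝ} (h : IsPrivateRobust c Q α β ε K) (hα : α ≤ α') (hβ : β ≤ β')
    (hε : ε ≤ ε') : IsPrivateRobust c Q α' β' ε' K where
  isDP x x' hx B hB := (h.isDP x x' hx B hB).trans (by gcongr)
  le_bind_apply p := calc
    ENNReal.ofReal (1 - β') ≤ ENNReal.ofReal (1 - β) := by gcongr
    _ ≤ (sampleLaw n p.1).bind K (closedBall p (c * infDist p Q + α)) := h.le_bind_apply p
    _ ≤ (sampleLaw n p.1).bind K (closedBall p (c * infDist p Q + α')) := by gcongr

lemma ofReal_one_sub_le_of_compl_le {Ω : Type*} [MeasurableSpace Ω] {μ : Measure Ω}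
    [IsProbabilityMeasure μ] {s : Set Ω} {β : ℝ} (hβ : 0 ≤ β)
    (h : μ sᶜ ≤ ENNReal.ofReal β) : ENNReal.ofReal (1 - β) ≤ μ s := by
  rw [ENNReal.ofReal_sub _ hβ, ENNReal.ofReal_one, tsub_le_iff_right]
  calc 1 = μ Set.univ := measure_univ.symm
    _ ≤ μ s + μ sᶜ := measure_univ_le_add_compl s
    _ ≤ μ s + ENNReal.ofReal β := by gcongr

theorem eventually_exists_isPrivateRobust (hQ : Q.Nonempty) (hQt : TotallyBounded Q)
    {α β ε : ℝ} (hα : 0 < α) (hβ : 0 < β) (hε : 0 < ε) :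
    ∀ᶠ n in atTop, ∃ K : Kernel (Fin n → X) (Distribution X),
      IsMarkovKernel K ∧ IsPrivateRobust 3 Q α β ε K := by
  obtain ⟨η, hη, rfl⟩ : ∃ η > 0, α = 10 * η := ⟨α / 10, by positivity, by ring⟩
  obtain ⟨T, -, hTfin, hT⟩ := finite_approx_of_totallyBounded hQt η hη
  have := hTfin.fintype
  obtain ⟨p₀, hp₀⟩ := hQ
  obtain ⟨q₀, hq₀, -⟩ := Set.mem_iUnion₂.1 (hT hp₀)
  have : Nonempty T := ⟨⟨q₀, hq₀⟩⟩
  obtain ⟨S, hS, hsep⟩ := exists_dist_le_dist_profile_add (fun q : T => q.1) hη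
  filter_upwards [(tendsto_div_add_mul_exp_neg (Fintype.card (T × T)) (Fintype.card T) hη
    hε).eventually_le_const hβ, eventually_gt_atTop 0] with n hbound hn
  refine ⟨minDistMechanism hS (fun q : T => q.1) ε n, inferInstance,
    isDP_minDistMechanism hS _ hε.le, fun p => ?_⟩
  obtain ⟨q, hqT, hpq⟩ := exists_dist_lt_infDist_add ⟨p₀, hp₀⟩ hη hT p
  calc ENNReal.ofReal (1 - β)
      ≤ (sampleLaw n p.1).bind (minDistMechanism hS _ ε n)
          (closedBall p (3 * dist p q + 4 * η)) :=
        ofReal_one_sub_le_of_compl_le hβ.le <|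
          (bind_minDistMechanism_apply_le hS hη hsep hε.le hn p ⟨q, hqT⟩).trans <|
            ENNReal.ofReal_le_ofReal hbound
    _ ≤ (sampleLaw n p.1).bind (minDistMechanism hS _ ε n)
          (closedBall p (3 * infDist p Q + 10 * η)) :=
        measure_mono (closedBall_subset_closedBall (by linarith))

theorem pureDPRobustlyLearnable_of_eventually [Nonempty (Distribution X)]
    (h : ∀ α > 0, ∀ β > 0, ∀ ε > 0, ∀ᶠ n in atTop,
      ∃ K : Kernel (Fin n → X) (Distribution X), IsMarkovKernel K ∧ IsPrivateRobust c Q α β ε K) :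
    PureDPRobustlyLearnable c Q := by
  obtain ⟨t, ht, hK⟩ := exists_tendsto_zero_eventually fun t ht => h t ht t ht t ht
  have hext (n : ℕ) : ∃ K : Kernel (Fin n → X) (Distribution X), IsMarkovKernel K ∧
      ((∃ K' : Kernel (Fin n → X) (Distribution X), IsMarkovKernel K' ∧
        IsPrivateRobust c Q (t n) (t n) (t n) K') → IsPrivateRobust c Q (t n) (t n) (t n) K) := by
    by_cases hn : ∃ K : Kernel (Fin n → X) (Distribution X), IsMarkovKernel K ∧
      IsPrivateRobust c Q (t n) (t n) (t n) K
    · exact hn.imp fun K hK => ⟨hK.1, fun _ => hK.2⟩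
    · exact ⟨Kernel.const _ (Measure.dirac (Classical.arbitrary _)), inferInstance, hn.elim⟩
  choose K hmarkov hrobust using hext
  have hlearn (α β ε : ℝ) : ∃ N, ∀ n ≥ N, 0 < α ∧ 0 < β ∧ 0 < ε →
      IsPrivateRobust c Q α β ε (K n) := by
    refine eventually_atTop.1 (eventually_imp_distrib_left.2 fun ⟨hα, hβ, hε⟩ => ?_)
    filter_upwards [hK, ht.eventually_le_const hα, ht.eventually_le_const hβ,
      ht.eventually_le_const hε] with n hn hαn hβn hεn
    exact (hrobust n hn).mono hαn hβn hεn
  choose N hN using hlearn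
  refine ⟨⟨K, hmarkov⟩, N, fun p α hα β hβ ε hε n hn => ?_⟩
  have hKn := hN α β ε n hn ⟨hα.1, hβ.1, hε.1⟩
  rw [Distribution.setOf_tvDist_le, ← Distribution.infDist_eq_tvDistTo]
  exact ⟨hKn.isDP, hKn.le_bind_apply p⟩

theorem pureDPRobustlyLearnable_of_totallyBounded (hQ : Q.Nonempty) (hQt : TotallyBounded Q) :
    PureDPRobustlyLearnable 3 Q :=
  have : Nonempty (Distribution X) := hQ.to_type
  pureDPRobustlyLearnable_of_eventually fun _ hα _ hβ _ hε =>
    eventually_exists_isPrivateRobust hQ hQt hα hβ hε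

end Learning

end DPRobust

end

theorem mainTheorem8 {X : Type*} [MeasurableSpace X] (Q : Set (DPRobust.Distribution X))
    (hQ : Q.Nonempty) (h : DPRobust.PureDPLearnable Q) :
    DPRobust.PureDPRobustlyLearnable 3 Q :=
  DPRobust.pureDPRobustlyLearnable_of_totallyBounded hQ h.totallyBounded
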